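/- **Setting.** Let $d$ be a (pseudo)metric on $F\cup C$, where $F$ is a finite, fixed set of facilities and $C=\{j_1,\dots,j_n\}$ is a set of $n\ge 2$ clients that arrive one by one. Let $1\le k\le |F|$, let $z\ge 0$ and $\ell\ge 1$ be integers, and let $0<\epsilon\le \frac12$ and $\gamma>0$ be real. For $p\ge 0$ put $d_p(u,v)=\min\{d(u,v),p\}$ and $d_p(u,S)=\min_{i\in S}d_p(u,i)$. When $j_1,\dots,j_t$ are the clients that have arrived so far, put $\mathrm{cost}_p(S)=0.1+\sum_{s=1}^{t}d_p(j_s,S)$ for $S\subseteq F$, $|S|=k$. An $\ell$-swap on $S$ is a pair $(A^*,A)$ with $A\subseteq S$, $A^*\subseteq F\setminus S$ and $|A|=|A^*|\le \ell$; it is $\rho$-efficient w.r.t. $p$ if $\mathrm{cost}_p((S\cup A^*)\setminus A)<\mathrm{cost}_p(S)-|A|\rho$. **Algorithm.** Start with an arbitrary $S\subseteq F$, $|S|=k$, and with $p=\min\{\frac1{10\gamma z},0.1\}$ ($p=0.1$ if $z=0$). At each time $t=1,\dots,n$: 1. the client $j_t$ arrives; 2. while there is an $\ell$-swap on $S$ that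 is $\rho$-efficient w.r.t. $p$ for $\rho=\epsilon\,\mathrm{cost}_p(S)/k$, perform such a swap (an arbitrary one); 3. if more than $\frac1{1-\epsilon}\left(1+\frac1\ell\right)(1+\gamma)z$ of the clients $j$ that have arrived have $d_p(j,S)=p$, replace $p$ by $2p$ and go back to 2. A *stage* is an inclusion-wise maximal period of the execution in which the value of $p$ does not change. Consider a stage with penalty $p$, let $\tau$ and $\tau'$ be the numbers of clients that have arrived when it begins and when it ends, respectively (so $\tau=0$ for the first stage), and for $T\in[\tau,\tau']$ let $\mathrm{opt}'_T=\min_{S'\subseteq F,\,|S'|=k}\left(0.1+\sum_{s=1}^{T}d_p(j_s,S')\right)$. Let $\Delta_\tau$ be the value of $\mathrm{cost}_p(S)$ at the beginning of the stage (immediately after the penalty is set to $p$), and for $t\in[\tau+1,\tau']$ let $\Delta_t$ be the value of $\mathrm{cost}_p(S)$ immediately after the arrival of $j_t$ minus its value immediately before. **Lemma.** There is an absolute constant $K>0$ such that for all such data, every execution of the algorithm, every stage of it and every $T\in[\tau,\tau']$, $$\sum_{t=\tau}^{T}\Delta_t\;\le\;K\,k\log n\cdot \mathrm{opt}'_T .$$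 -/

import Mathlib

noncomputable section

namespace OnlineKMedian

/-- Input data and parameters of the online algorithm for `k`-median with outliers in the static
facility setting: the facility set `F`, the total number `n` of clients, the clients
`client 1, …, client n` in order of arrival (values of `client` outside `1, …, n` are never
used), the number `k` of medians, the number `z` of outliers, the swap size `ell`, and the
parameters `eps` and `gam`. The metric is that of `X`. -/
structure Input (X : Type*) where
  F : Finset X
  n : ℕ
  client : ℕ → X
  k : ℕ
  z : ℕ
  ell : ℕ
  eps : ℝ
  gam : ℝ

section Costs

variable {X : Type*} [PseudoMetricSpace X]

/-- The truncated metric `d_p(u, v) = min {d(u, v), p}`. -/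
def dp (p : ℝ) (u v : X) : ℝ := min (dist u v) p

/-- `d_p(u, S) = min_{i ∈ S} d_p(u, i)`, for a nonempty finite set `S`. -/
def dpSet (p : ℝ) (u : X) (S : Finset X) : ℝ := ⨅ i : {x // x ∈ S}, dp p u i.1

/-- `cost_p(S)` when the current clients are `client 1, …, client t`; it contains the additive
term `0.1` that keeps all costs positive. -/
def cost (I : Input X) (t : ℕ) (p : ℝ) (S : Finset X) : ℝ :=
  1 / 10 + ∑ i ∈ Finset.Icc 1 t, dpSet p (I.client i) S

/-- `opt'`: the minimum of `cost_p(S')` over all `S' ⊆ F` with `|S'| = k`, when the current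
clients are `client 1, …, client t`. -/
def optPrime (I : Input X) (t : ℕ) (p : ℝ) : ℝ :=
  ⨅ S : {S : Finset X // S ∈ I.F.powersetCard I.k}, cost I t p S.1

/-- The number of current clients `j` with `d_p(j, S) = p`. -/
def numOutliers (I : Input X) (t : ℕ) (p : ℝ) (S : Finset X) : ℕ :=
  ((Finset.Icc 1 t).filter fun i => dpSet p (I.client i) S = p).card

/-- The number of outliers above which the penalty is doubled:
`(1 / (1 - ε)) (1 + 1 / ℓ) (1 + γ) z`. -/
def outlierThreshold (I : Input X) : ℝ :=
  1 / (1 - I.eps) * (1 + 1 / (I.ell : ℝ)) * (1 + I.gam) * (I.z : ℝ)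

/-- The initial penalty `min {1 / (10 γ z), 0.1}`, where `1 / 0 = ∞` if `z = 0`. -/
def initPenalty (I : Input X) : ℝ :=
  if I.z = 0 then 1 / 10 else min (1 / (10 * I.gam * (I.z : ℝ))) (1 / 10)

/-- The efficiency parameter `ρ = ε · cost_p(S) / k`. -/
def rho (I : Input X) (t : ℕ) (p : ℝ) (S : Finset X) : ℝ :=
  I.eps * cost I t p S / (I.k : ℝ)

variable [DecidableEq X]

/-- `(A', A)` is an `ℓ`-swap on `S`: `A'` is swapped in and `A` is swapped out. -/
def IsSwap (I : Input X) (S A' A : Finset X) : Prop :=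
  A ⊆ S ∧ A' ⊆ I.F \ S ∧ A.card = A'.card ∧ A.card ≤ I.ell

/-- `(A', A)` is an `r`-efficient `ℓ`-swap on `S` w.r.t. the penalty cost `p`. -/
def IsEfficientSwap (I : Input X) (t : ℕ) (p r : ℝ) (S A' A : Finset X) : Prop :=
  IsSwap I S A' A ∧ cost I t p ((S ∪ A') \ A) < cost I t p S - (A.card : ℝ) * r

/-- No `ρ`-efficient `ℓ`-swap exists, i.e. the while loop is over. -/
def NoEfficientSwap (I : Input X) (t : ℕ) (p : ℝ) (S : Finset X) : Prop :=
  ∀ A' A : Finset X, ¬ IsEfficientSwap I t p (rho I t p S) S A' A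

end Costs

/-- Position in the algorithm: `waiting` is between two iterations of the for loop (the next
action is the arrival of a client), `searching` is inside an iteration, after the arrival. -/
inductive Phase where
  | waiting
  | searching

/-- A configuration of the algorithm: `time` is the number of clients that have arrived. -/
structure Config (X : Type*) where
  time : ℕ
  medians : Finset X
  penalty : ℝ
  phase : Phase

section Algorithm

variable {X : Type*} [PseudoMetricSpace X] [DecidableEq X]

/-- The initial configurations; the initial set of `k` medians is arbitrary. -/
def IsInitial (I : Input X) (c : Config X) : Prop :=
  c.time = 0 ∧ c.medians ⊆ I.F ∧ c.medians.card = I.k ∧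
    c.penalty = initPenalty I ∧ c.phase = Phase.waiting

/-- One step of the algorithm: arrival of the next client; one iteration of the while loop
(any efficient swap may be chosen); doubling the penalty if, after the while loop, there are too
many outliers; ending the current iteration of the for loop otherwise. -/
inductive Step (I : Input X) : Config X → Config X → Prop
  | arrive (t : ℕ) (S : Finset X) (p : ℝ) (ht : t < I.n) :
      Step I ⟨t, S, p, Phase.waiting⟩ ⟨t + 1, S, p, Phase.searching⟩
  | swap (t : ℕ) (S : Finset X) (p : ℝ) (A' A : Finset X)
      (h : IsEfficientSwap I t p (rho I t p S) S A' A) :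
      Step I ⟨t, S, p, Phase.searching⟩ ⟨t, (S ∪ A') \ A, p, Phase.searching⟩
  | double (t : ℕ) (S : Finset X) (p : ℝ) (h : NoEfficientSwap I t p S)
      (ho : outlierThreshold I < (numOutliers I t p S : ℝ)) :
      Step I ⟨t, S, p, Phase.searching⟩ ⟨t, S, 2 * p, Phase.searching⟩
  | finish (t : ℕ) (S : Finset X) (p : ℝ) (h : NoEfficientSwap I t p S)
      (ho : (numOutliers I t p S : ℝ) ≤ outlierThreshold I) :
      Step I ⟨t, S, p, Phase.searching⟩ ⟨t, S, p, Phase.waiting⟩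

/-- `c 0, …, c N` are the successive configurations of a (possibly partial) execution. -/
def IsRun (I : Input X) (c : ℕ → Config X) (N : ℕ) : Prop :=
  IsInitial I (c 0) ∧ ∀ i, i < N → Step I (c i) (c (i + 1))

end Algorithm

section Stages

variable {X : Type*}

/-- The moments `a, …, b` form a stage of the execution `c 0, …, c N`: an inclusion-wise maximal
period in which the penalty does not change. -/
structure IsStage (c : ℕ → Config X) (N a b : ℕ) : Prop where
  le : a ≤ b
  le_end : b ≤ N
  const : ∀ i, a ≤ i → i ≤ b → (c i).penalty = (c a).penalty
  maximal_left : ∀ i, i + 1 = a → (c i).penalty ≠ (c a).penalty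
  maximal_right : b < N → (c (b + 1)).penalty ≠ (c a).penalty

/-- The moment right after the arrival of client `t`: the first one at which `t` clients have
arrived. -/
def arrivalMoment (c : ℕ → Config X) (t : ℕ) : ℕ := sInf {i | (c i).time = t}

variable [PseudoMetricSpace X]

/-- The value of `cost_p(S)` at moment `i` of the execution, for the current clients and the
current medians. -/
def costAt (I : Input X) (c : ℕ → Config X) (p : ℝ) (i : ℕ) : ℝ :=
  cost I (c i).time p (c i).medians

/-- `Δ_t` for a stage that begins at moment `a`, with penalty `p = (c a).penalty`. If `t` is the
time at which the stage begins, `Δ_t` is the value of `cost_p(S)` at the beginning of the stage;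
for later times `t` of the stage it is the value of `cost_p(S)` right after the arrival of client
`t` minus the value right before. -/
def Delta (I : Input X) (c : ℕ → Config X) (a t : ℕ) : ℝ :=
  if t = (c a).time then costAt I c (c a).penalty a
  else costAt I c (c a).penalty (arrivalMoment c t) -
    costAt I c (c a).penalty (arrivalMoment c t - 1)

end Stages

end OnlineKMedian

end

namespace OnlineKMedian

open Finset

/-! ### Truncated distances -/

section Distances

variable {X : Type*} [PseudoMetricSpace X]

/-! Fix a solution `S'` that is optimal for the first `T` clients, with cost `B`; its cost for fewer
clients is at most `B`. Two facts bound each arrival.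

Just before an arrival the current medians `S` are a local optimum, hence cost at most `14 * B`
(`cost_le_of_noEfficientSwap`, the classical single-swap analysis). If the new client belongs to the
cluster of `o ∈ S'` and `m ≥ 1` earlier clients do too, each of them bounds the distance from `o` to
`S` by its own cost in `S` plus its own cost in `S'`. Averaging over them, this distance is `O(B /
m)`, and the new client pays at most this plus its cost in `S'` (`dpSet_arrival_le`). The first
client of a cluster pays at most `p`, which is also `O(B)`: when `p/2` was doubled, some client paid
`p/2` in a local optimum.

Over one cluster the terms `1 / (m + 1)` form a harmonic number, so the `k` clusters contribute `O(k
log n) * B` (`sum_inv_classCount_le`), while the costs in `S'` add up to at most `B`. The starting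
value is `O(B)` because doubling the penalty at most doubles the cost of a local optimum
(`IsStage.start_le`). -/

lemma dp_nonneg {p : ℝ} (hp : 0 ≤ p) (u v : X) : 0 ≤ dp p u v :=
  le_min dist_nonneg hp

lemma dp_comm (p : ℝ) (u v : X) : dp p u v = dp p v u := by
  simp [dp, dist_comm]

lemma dp_triangle {p : ℝ} (hp : 0 ≤ p) (u v w : X) : dp p u w ≤ dp p u v + dp p v w := by
  have h := dist_triangle u v w
  have h1 : 0 ≤ dist u v := dist_nonneg
  have h2 : 0 ≤ dist v w := dist_nonneg
  unfold dp
  rcases min_cases (dist u v) p with h3 | h3 <;> rcases min_cases (dist v w) p with h4 | h4 <;>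
    rcases min_cases (dist u w) p with h5 | h5 <;> linarith

lemma dpSet_le (p : ℝ) (u : X) {S : Finset X} {v : X} (hv : v ∈ S) : dpSet p u S ≤ dp p u v :=
  ciInf_le (Set.finite_range fun i : {x // x ∈ S} => dp p u i.1).bddBelow ⟨v, hv⟩

lemma exists_dpSet_eq (p : ℝ) (u : X) {S : Finset X} (hS : S.Nonempty) :
    ∃ v ∈ S, dpSet p u S = dp p u v := by
  have : Nonempty {x // x ∈ S} := hS.to_subtype
  obtain ⟨v, hv⟩ := exists_eq_ciInf_of_finite (f := fun i : {x // x ∈ S} => dp p u i.1)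
  exact ⟨v.1, v.2, hv.symm⟩

lemma dpSet_nonneg {p : ℝ} (hp : 0 ≤ p) (u : X) (S : Finset X) : 0 ≤ dpSet p u S :=
  Real.iInf_nonneg fun _ => dp_nonneg hp _ _

lemma dpSet_anti (p : ℝ) (u : X) {S S' : Finset X} (hS : S.Nonempty) (h : S ⊆ S') :
    dpSet p u S' ≤ dpSet p u S := by
  obtain ⟨v, hv, he⟩ := exists_dpSet_eq p u hS
  exact he ▸ dpSet_le p u (h hv)

lemma dpSet_le_penalty (p : ℝ) (u : X) {S : Finset X} (hS : S.Nonempty) : dpSet p u S ≤ p := by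
  obtain ⟨v, _, he⟩ := exists_dpSet_eq p u hS
  exact he ▸ min_le_right _ _

lemma dpSet_le_add {p : ℝ} (hp : 0 ≤ p) (u v : X) {S : Finset X} (hS : S.Nonempty) :
    dpSet p u S ≤ dp p u v + dpSet p v S := by
  obtain ⟨w, hw, he⟩ := exists_dpSet_eq p v hS
  rw [he]
  exact (dpSet_le p u hw).trans (dp_triangle hp u v w)

lemma dpSet_mono_penalty {p q : ℝ} (hpq : p ≤ q) (u : X) {S : Finset X} (hS : S.Nonempty) :
    dpSet p u S ≤ dpSet q u S := by
  obtain ⟨w, hw, he⟩ := exists_dpSet_eq q u hS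
  rw [he]
  exact (dpSet_le p u hw).trans (min_le_min_left _ hpq)

lemma dpSet_two_mul_le (p : ℝ) (u : X) {S : Finset X} (hS : S.Nonempty) :
    dpSet (2 * p) u S ≤ 2 * dpSet p u S := by
  obtain ⟨w, hw, he⟩ := exists_dpSet_eq p u hS
  rw [he]
  refine (dpSet_le _ u hw).trans ?_
  have h1 : 0 ≤ dist u w := dist_nonneg
  unfold dp
  rcases min_cases (dist u w) p with h3 | h3 <;>
    rcases min_cases (dist u w) (2 * p) with h4 | h4 <;> linarith

end Distances

/-! ### Monotonicity and scaling of the cost -/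

section CostBounds

variable {X : Type*} [PseudoMetricSpace X]

lemma cost_anti (I : Input X) (t : ℕ) (p : ℝ) {S S' : Finset X} (hS : S.Nonempty) (h : S ⊆ S') :
    cost I t p S' ≤ cost I t p S :=
  add_le_add_right (sum_le_sum fun _ _ => dpSet_anti p _ hS h) _

lemma cost_mono_time (I : Input X) {t t' : ℕ} (h : t ≤ t') {p : ℝ} (hp : 0 ≤ p) (S : Finset X) :
    cost I t p S ≤ cost I t' p S :=
  add_le_add_right (sum_le_sum_of_subset_of_nonneg (Icc_subset_Icc_right h)
    fun _ _ _ => dpSet_nonneg hp _ _) _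

lemma cost_mono_penalty (I : Input X) (t : ℕ) {p q : ℝ} (h : p ≤ q) {S : Finset X}
    (hS : S.Nonempty) : cost I t p S ≤ cost I t q S :=
  add_le_add_right (sum_le_sum fun _ _ => dpSet_mono_penalty h _ hS) _

lemma cost_two_mul_le (I : Input X) (t : ℕ) (p : ℝ) {S : Finset X} (hS : S.Nonempty) :
    cost I t (2 * p) S ≤ 2 * cost I t p S := by
  unfold cost
  have h : ∑ i ∈ Icc 1 t, dpSet (2 * p) (I.client i) S ≤
      ∑ i ∈ Icc 1 t, 2 * dpSet p (I.client i) S :=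
    sum_le_sum fun _ _ => dpSet_two_mul_le p _ hS
  rw [← mul_sum] at h
  linarith

lemma le_cost (I : Input X) (t : ℕ) {p : ℝ} (hp : 0 ≤ p) (S : Finset X) :
    1 / 10 ≤ cost I t p S :=
  le_add_of_nonneg_right (sum_nonneg fun _ _ => dpSet_nonneg hp _ _)

lemma cost_succ (I : Input X) (t : ℕ) (p : ℝ) (S : Finset X) :
    cost I (t + 1) p S = cost I t p S + dpSet p (I.client (t + 1)) S := by
  simp only [cost]
  rw [sum_Icc_succ_top (by omega), add_assoc]

lemma penalty_le_cost (I : Input X) (t : ℕ) {p : ℝ} (hp : 0 ≤ p) (S : Finset X)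
    (h : 0 < numOutliers I t p S) : p ≤ cost I t p S := by
  obtain ⟨i, hi⟩ := card_pos.mp h
  rw [mem_filter] at hi
  have := single_le_sum (f := fun i => dpSet p (I.client i) S)
    (fun i _ => dpSet_nonneg hp (I.client i) S) hi.1
  simp only [hi.2] at this
  unfold cost
  linarith

lemma exists_optPrime_eq (I : Input X) (t : ℕ) (p : ℝ) (hk : I.k ≤ I.F.card) :
    ∃ S ⊆ I.F, S.card = I.k ∧ optPrime I t p = cost I t p S := by
  obtain ⟨S₀, hS₀, hc⟩ := exists_subset_card_eq hk
  have : Nonempty {S : Finset X // S ∈ I.F.powersetCard I.k} :=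
    ⟨⟨S₀, mem_powersetCard.mpr ⟨hS₀, hc⟩⟩⟩
  obtain ⟨S, hS⟩ := exists_eq_ciInf_of_finite
    (f := fun S : {S : Finset X // S ∈ I.F.powersetCard I.k} => cost I t p S.1)
  obtain ⟨h1, h2⟩ := mem_powersetCard.mp S.2
  exact ⟨S.1, h1, h2, hS.symm⟩

end CostBounds

/-! ### The combinatorial pairing behind the swap analysis -/

/-- A map `φ` between finite sets `T` and `S` of equal size admits a pairing `σ` of `T` with
elements of `S` such that `σ o` has no `φ`-preimage other than `o`, and no element of `S` is used
more than three times. -/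
lemma exists_swap_pairing {X : Type*} [DecidableEq X] {S T : Finset X} (hc : S.card = T.card)
    (φ : X → X) (hφ : ∀ o ∈ T, φ o ∈ S) :
    ∃ σ : X → X, (∀ o ∈ T, σ o ∈ S ∧ ∀ o' ∈ T, o' ≠ o → φ o' ≠ σ o) ∧
      ∀ s, (T.filter fun o => σ o = s).card ≤ 3 := by
  classical
  -- Elements of `O` are alone in their fibre of `φ` and are paired with `φ o`. The others, `R`, are
  -- paired with elements of `Z`, which have no preimage at all.
  set P : X → Prop := fun o => ∀ o' ∈ T, φ o' = φ o → o' = o with hP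
  set O := T.filter P with hO
  set R := T.filter fun o => ¬ P o with hR
  set Z := S \ T.image φ
  have hOR : O.card + R.card = T.card := card_filter_add_card_filter_not (s := T) P
  have himS : T.image φ ⊆ S := image_subset_iff.mpr hφ
  have hZ : Z.card + (T.image φ).card = S.card := card_sdiff_add_card_eq_card himS
  have him : (T.image φ).card ≤ O.card + (R.image φ).card := by
    have : T.image φ = O.image φ ∪ R.image φ := by
      rw [← image_union, hO, hR, filter_union_filter_not_eq]
    rw [this]
    exact (card_union_le _ _).trans (Nat.add_le_add_right card_image_le _)
  have hRim : 2 * (R.image φ).card ≤ R.card := by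
    refine mul_card_image_le_card (f := φ) R 2 fun s hs => ?_
    obtain ⟨o, ho, rfl⟩ := mem_image.mp hs
    obtain ⟨hoT, hno⟩ := mem_filter.mp ho
    simp only [hP, not_forall] at hno
    obtain ⟨o', ho'T, he, hne⟩ := hno
    have ho' : o' ∈ R := mem_filter.mpr
      ⟨ho'T, fun h => hne (h o hoT he.symm).symm⟩
    refine one_lt_card.mpr ⟨o', ?_, o, ?_, hne⟩ <;> simp [ho, ho', he]
  -- Fibres meeting `R` have at least two elements, so the image of `φ` misses at least `R.card / 2`
  -- elements of `S`. The embedding into `Z × Bool` then uses each of them at most twice.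
  have hRZ : R.card ≤ 2 * Z.card := by omega
  have hcard : Fintype.card R ≤ Fintype.card (Z × Bool) := by
    simp only [Fintype.card_prod, Fintype.card_coe, Fintype.card_bool]; omega
  obtain ⟨g⟩ := Function.Embedding.nonempty_of_card_le hcard
  set σ : X → X := fun o => if h : o ∈ R then (g ⟨o, h⟩).1.1 else φ o with hσ
  have hσR : ∀ o (h : o ∈ R), σ o = (g ⟨o, h⟩).1.1 := fun o h => dif_pos h
  have hσO : ∀ o, o ∉ R → σ o = φ o := fun o h => dif_neg h
  refine ⟨σ, fun o ho => ?_, fun s => ?_⟩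
  · by_cases h : o ∈ R
    · rw [hσR o h]
      have hz := mem_sdiff.mp (g ⟨o, h⟩).1.2
      exact ⟨hz.1, fun o' ho' _ he => hz.2 (mem_image.mpr ⟨o', ho', he⟩)⟩
    · rw [hσO o h]
      have hPo : P o := by
        by_contra hn
        exact h (mem_filter.mpr ⟨ho, hn⟩)
      exact ⟨hφ o ho, fun o' ho' hne he => hne (hPo o' ho' he)⟩
  · have hsplit : (T.filter fun o => σ o = s) ⊆
        (O.filter fun o => φ o = s) ∪ R.filter fun o => σ o = s := by
      intro o ho
      obtain ⟨hoT, hos⟩ := mem_filter.mp ho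
      by_cases h : o ∈ R
      · exact mem_union_right _ (mem_filter.mpr ⟨h, hos⟩)
      · refine mem_union_left _ (mem_filter.mpr ⟨mem_filter.mpr ⟨hoT, ?_⟩, hσO o h ▸ hos⟩)
        by_contra hn
        exact h (mem_filter.mpr ⟨hoT, hn⟩)
    have h1 : (O.filter fun o => φ o = s).card ≤ 1 := by
      refine card_le_one.mpr fun x hx y hy => ?_
      obtain ⟨hx, hxs⟩ := mem_filter.mp hx
      obtain ⟨hy, hys⟩ := mem_filter.mp hy
      exact (mem_filter.mp hy).2 x (mem_filter.mp hx).1 (hxs.trans hys.symm)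
    have h2 : (R.filter fun o => σ o = s).card ≤ 2 := by
      have : (R.filter fun o => σ o = s).card ≤ (univ : Finset Bool).card := by
        refine card_le_card_of_injOn (fun o => if h : o ∈ R then (g ⟨o, h⟩).2 else true)
          (fun _ _ => mem_coe.mpr (mem_univ _)) ?_
        intro x hx y hy hxy
        obtain ⟨hx, hxs⟩ := mem_filter.mp (mem_coe.mp hx)
        obtain ⟨hy, hys⟩ := mem_filter.mp (mem_coe.mp hy)
        simp only [hx, hy, dif_pos] at hxy
        rw [hσR x hx] at hxs
        rw [hσR y hy] at hys
        have := g.injective (Prod.ext (Subtype.ext (hxs.trans hys.symm)) hxy)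
        exact congrArg Subtype.val this
      simpa using this
    exact (card_le_card hsplit).trans ((card_union_le _ _).trans (add_le_add h1 h2))

/-! ### Local optima are constant-factor approximations -/

section LocalSearch

variable {X : Type*} [PseudoMetricSpace X] [DecidableEq X]

/-- When `o ∈ S` this is not a legal swap, but then the new set lies inside `S` and cannot be
cheaper. Hence the swap analysis need not separate common facilities. -/
lemma cost_le_cost_singleSwap_add (I : Input X) {t : ℕ} {p : ℝ} (hp : 0 ≤ p) {S : Finset X}
    (hell : 1 ≤ I.ell) (heps : 0 < I.eps) (h : NoEfficientSwap I t p S) {o s : X} (ho : o ∈ I.F)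
    (hs : s ∈ S) : cost I t p S ≤ cost I t p (insert o (S.erase s)) + rho I t p S := by
  have hrho : 0 ≤ rho I t p S := by
    have := le_cost I t hp S
    unfold rho
    positivity
  by_cases hoS : o ∈ S
  · have hsub : insert o (S.erase s) ⊆ S :=
      insert_subset hoS (erase_subset _ _)
    have := cost_anti I t p (insert_nonempty o (S.erase s)) hsub
    linarith
  · have hne : o ≠ s := fun he => hoS (he ▸ hs)
    have hset : (S ∪ {o}) \ {s} = insert o (S.erase s) := by
      ext x
      simp only [mem_sdiff, mem_union, mem_singleton, mem_insert, mem_erase]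
      constructor
      · tauto
      · rintro (rfl | hx)
        · exact ⟨Or.inr rfl, hne⟩
        · exact ⟨Or.inl hx.2, hx.1⟩
    have := h {o} {s}
    unfold IsEfficientSwap IsSwap at this
    rw [hset] at this
    simp only [singleton_subset_iff, mem_sdiff, card_singleton, hs, ho, hoS, hell, true_and,
      not_false_eq_true, not_lt, Nat.cast_one, one_mul] at this
    linarith

/-- A local optimum of the swap local search is within a constant factor of every solution. -/
lemma cost_le_of_noEfficientSwap (I : Input X) {t : ℕ} {p : ℝ} (hp : 0 ≤ p) {S T : Finset X}
    (hk : 1 ≤ I.k) (hell : 1 ≤ I.ell) (heps : 0 < I.eps) (heps' : I.eps ≤ 1 / 2)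
    (hSk : S.card = I.k) (hTF : T ⊆ I.F) (hTk : T.card = I.k) (h : NoEfficientSwap I t p S) :
    cost I t p S ≤ 14 * cost I t p T := by
  have hS : S.Nonempty := card_pos.mp (by omega)
  have hT : T.Nonempty := card_pos.mp (by omega)
  choose nS hnS hnS' using fun u : X => exists_dpSet_eq p u hS
  choose nT hnT hnT' using fun u : X => exists_dpSet_eq p u hT
  obtain ⟨σ, hσ, hfib⟩ := exists_swap_pairing (hSk.trans hTk.symm) nS fun o _ => hnS o
  set x := I.client
  -- Clients of `o` move to `o`. Any other client losing its median goes to the element of `S`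
  -- nearest to its center in `T`, which the pairing keeps from being removed; the detour costs at
  -- most twice its cost in `T`. The rest stay.
  have hpt : ∀ o ∈ T, ∀ j, dpSet p (x j) (insert o (S.erase (σ o))) ≤ dpSet p (x j) S +
      ((if nT (x j) = o then dpSet p (x j) T - dpSet p (x j) S else 0) +
        if σ o = nS (x j) then 2 * dpSet p (x j) T else 0) := by
    intro o ho j
    have hnn := dpSet_nonneg hp (x j) T
    by_cases h1 : nT (x j) = o
    · rw [if_pos h1]
      have := dpSet_le p (x j) (mem_insert_self o (S.erase (σ o)))
      have h2 := hnT' (x j)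
      rw [h1] at h2
      split_ifs <;> linarith
    · rw [if_neg h1]
      split_ifs with h2
      · have hmem : nS (nT (x j)) ∈ insert o (S.erase (σ o)) :=
          mem_insert_of_mem (mem_erase.mpr ⟨(hσ o ho).2 _ (hnT _) h1, hnS _⟩)
        have e1 := dpSet_le p (x j) hmem
        have e2 := dp_triangle hp (x j) (nT (x j)) (nS (nT (x j)))
        have e3 := dpSet_le p (nT (x j)) (hnS (x j))
        have e4 := dp_triangle hp (nT (x j)) (x j) (nS (x j))
        rw [dp_comm p (nT (x j)) (x j)] at e4
        linarith [hnS' (nT (x j)), hnS' (x j), hnT' (x j)]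
      · have hmem : nS (x j) ∈ insert o (S.erase (σ o)) :=
          mem_insert_of_mem (mem_erase.mpr ⟨fun he => h2 he.symm, hnS _⟩)
        have e1 := dpSet_le p (x j) hmem
        linarith [hnS' (x j)]
  have hsw : ∀ o ∈ T, -rho I t p S ≤ ∑ j ∈ Icc 1 t,
      ((if nT (x j) = o then dpSet p (x j) T - dpSet p (x j) S else 0) +
        if σ o = nS (x j) then 2 * dpSet p (x j) T else 0) := by
    intro o ho
    have e1 := cost_le_cost_singleSwap_add I hp hell heps h (hTF ho) (hσ o ho).1
    have e2 := sum_le_sum fun j (_ : j ∈ Icc 1 t) => hpt o ho j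
    rw [sum_add_distrib] at e2
    unfold cost at e1
    linarith
  have hsum := sum_le_sum hsw
  rw [sum_const, sum_comm, hTk, nsmul_eq_mul] at hsum
  -- Each client gains once, and its median is removed at most three times: `7 = 1 + 3 * 2`.
  have hbound : ∀ j ∈ Icc 1 t, ∑ o ∈ T,
      ((if nT (x j) = o then dpSet p (x j) T - dpSet p (x j) S else 0) +
        if σ o = nS (x j) then 2 * dpSet p (x j) T else 0) ≤
      7 * dpSet p (x j) T - dpSet p (x j) S := by
    intro j _
    rw [sum_add_distrib, sum_ite_eq, if_pos (hnT _), ← sum_filter, sum_const, nsmul_eq_mul]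
    have hnn := dpSet_nonneg hp (x j) T
    have h3 : ((T.filter fun o => σ o = nS (x j)).card : ℝ) ≤ 3 := by
      exact_mod_cast hfib (nS (x j))
    have := mul_le_mul_of_nonneg_right h3 (by positivity : (0 : ℝ) ≤ 2 * dpSet p (x j) T)
    linarith
  have hall := hsum.trans (sum_le_sum hbound)
  rw [sum_sub_distrib, ← mul_sum] at hall
  have hkr : (I.k : ℝ) * rho I t p S = I.eps * cost I t p S := by
    have : (I.k : ℝ) ≠ 0 := by exact_mod_cast (by omega : I.k ≠ 0)
    unfold rho
    field_simp
  have hc := le_cost I t hp S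
  -- The `k` efficiency slacks absorb at most half of the cost, which turns 7 into 14.
  have he : I.eps * cost I t p S ≤ 1 / 2 * cost I t p S :=
    mul_le_mul_of_nonneg_right heps' (by linarith)
  have hS' : cost I t p S = 1 / 10 + ∑ j ∈ Icc 1 t, dpSet p (x j) S := rfl
  have hT' : cost I t p T = 1 / 10 + ∑ j ∈ Icc 1 t, dpSet p (x j) T := rfl
  linarith

end LocalSearch

/-! ### Harmonic sums over clusters -/

section Clusters

/-- The number of the clients `1, …, t` that a classification `f` puts into class `o`. -/
def classCount {X : Type*} [DecidableEq X] (f : ℕ → X) (t : ℕ) (o : X) : ℕ :=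
  ((Icc 1 t).filter fun i => f i = o).card

lemma classCount_succ {X : Type*} [DecidableEq X] (f : ℕ → X) (t : ℕ) (o : X) :
    classCount f (t + 1) o = classCount f t o + if f (t + 1) = o then 1 else 0 := by
  unfold classCount
  rw [card_filter, card_filter, sum_Icc_succ_top (by omega)]

/-- A client joining a class of size `m` contributes exactly the next term `1 / (m + 1)` of the
harmonic number of that class. -/
lemma sum_inv_classCount_eq {X : Type*} [DecidableEq X] (f : ℕ → X) {S : Finset X}
    (hf : ∀ i, f i ∈ S) (t : ℕ) :
    ∑ i ∈ Icc 1 t, ((classCount f (i - 1) (f i) : ℚ) + 1)⁻¹ =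
      ∑ o ∈ S, harmonic (classCount f t o) := by
  induction t with
  | zero => simp [classCount]
  | succ t ih =>
    have hstep : ∀ o ∈ S, harmonic (classCount f (t + 1) o) = harmonic (classCount f t o) +
        if f (t + 1) = o then ((classCount f t o : ℚ) + 1)⁻¹ else 0 := by
      intro o _
      rw [classCount_succ]
      split_ifs
      · rw [harmonic_succ]; push_cast; rfl
      · simp
    rw [sum_Icc_succ_top (by omega), ih, sum_congr rfl hstep, sum_add_distrib, sum_ite_eq,
      if_pos (hf _), Nat.add_sub_cancel]

lemma sum_inv_classCount_le {X : Type*} [DecidableEq X] (f : ℕ → X) {S : Finset X}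
    (hf : ∀ i, f i ∈ S) {t n : ℕ} (hn : 1 ≤ n) (ht : t ≤ n) :
    ∑ i ∈ Icc 1 t, ((classCount f (i - 1) (f i) : ℝ) + 1)⁻¹ ≤ S.card * (1 + Real.log n) := by
  have h := congrArg (fun q : ℚ => (q : ℝ)) (sum_inv_classCount_eq f hf t)
  push_cast at h
  rw [h, ← nsmul_eq_mul]
  refine sum_le_card_nsmul _ _ _ fun o _ => ?_
  have hc : classCount f t o ≤ n := by
    refine (card_filter_le _ _).trans ?_
    simpa using ht
  refine (harmonic_le_one_add_log _).trans ?_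
  rcases Nat.eq_zero_or_pos (classCount f t o) with h0 | h0
  · simp only [h0, Nat.cast_zero, Real.log_zero]
    have := Real.log_nonneg (by exact_mod_cast hn : (1 : ℝ) ≤ n)
    linarith
  · have := Real.log_le_log (by exact_mod_cast h0 : (0 : ℝ) < classCount f t o)
      (by exact_mod_cast hc : (classCount f t o : ℝ) ≤ n)
    linarith

end Clusters

/-! ### Cost of a single arrival -/

section Arrivals

variable {X : Type*} [PseudoMetricSpace X] [DecidableEq X]

/-- The connection cost of an arriving client to a solution `S` is at most its cost in a solution
`T`, plus the share of the total costs of `S` and `T` that falls on each earlier client of the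
same cluster of `T`. -/
lemma dpSet_arrival_le (I : Input X) {p : ℝ} (hp : 0 ≤ p) (t : ℕ) {S T : Finset X}
    (hS : S.Nonempty) (f : ℕ → X) (hf : ∀ i, dpSet p (I.client i) T = dp p (I.client i) (f i))
    {B : ℝ} (hpB : p ≤ B) (hB : cost I t p S + cost I t p T ≤ B) :
    dpSet p (I.client (t + 1)) S ≤ dpSet p (I.client (t + 1)) T +
      2 * B * ((classCount f t (f (t + 1)) : ℝ) + 1)⁻¹ := by
  set m := classCount f t (f (t + 1)) with hm
  set o := f (t + 1) with ho
  have hT := dpSet_nonneg hp (I.client (t + 1)) T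
  have hB0 : 0 ≤ B := hp.trans hpB
  -- The first client of a cluster has nobody to average over; truncation bounds its cost by `p ≤
  -- B`.
  rcases Nat.eq_zero_or_pos m with h0 | h0
  · rw [h0]
    have := dpSet_le_penalty p (I.client (t + 1)) hS
    norm_num
    linarith
  have hm1 : (1 : ℝ) ≤ m := by exact_mod_cast h0
  have hmo : (m : ℝ) * dpSet p o S ≤ B := by
    have h1 : ∀ j ∈ (Icc 1 t).filter (fun i => f i = o),
        dpSet p o S ≤ dpSet p (I.client j) S + dpSet p (I.client j) T := by
      intro j hj
      have := dpSet_le_add hp o (I.client j) hS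
      rw [dp_comm, ← (mem_filter.mp hj).2, ← hf j] at this
      rw [← (mem_filter.mp hj).2]
      linarith
    have h2 := card_nsmul_le_sum _ _ _ h1
    rw [nsmul_eq_mul] at h2
    have h3 := sum_le_sum_of_subset_of_nonneg
      (filter_subset (fun i => f i = o) (Icc 1 t))
      (fun j _ _ => add_nonneg (dpSet_nonneg hp (I.client j) S) (dpSet_nonneg hp (I.client j) T))
    rw [sum_add_distrib (s := Icc 1 t)] at h3
    unfold cost at hB
    have h4 : (m : ℝ) * dpSet p o S = (((Icc 1 t).filter fun i => f i = o).card : ℝ) *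
      dpSet p o S := rfl
    linarith
  have hpos : (0 : ℝ) < m + 1 := by linarith
  -- The factor 2 pays for `m + 1 ≤ 2 * m`, so that the case `m = 0` has the same form.
  have hds : dpSet p o S ≤ 2 * B * ((m : ℝ) + 1)⁻¹ := by
    rw [← div_eq_mul_inv, le_div_iff₀ hpos]
    have h5 := dpSet_nonneg hp o S
    nlinarith
  have h6 := dpSet_le_add hp (I.client (t + 1)) o hS
  rw [ho, ← hf (t + 1)] at h6
  linarith

end Arrivals

lemma initPenalty_pos {X : Type*} (I : Input X) (hgam : 0 < I.gam) : 0 < initPenalty I := by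
  unfold initPenalty
  split_ifs with h
  · norm_num
  · have : (0 : ℝ) < I.z := by exact_mod_cast Nat.pos_of_ne_zero h
    exact lt_min (by positivity) (by norm_num)

lemma initPenalty_le {X : Type*} (I : Input X) : initPenalty I ≤ 1 / 10 := by
  unfold initPenalty
  split_ifs
  · rfl
  · exact min_le_right _ _

/-! ### Invariants of executions, and stages -/

section Runs

variable {X : Type*} [PseudoMetricSpace X] [DecidableEq X]

/-- What holds at every moment of an execution. -/
structure Invariant (I : Input X) (x : Config X) : Prop where
  subset : x.medians ⊆ I.F
  card : x.medians.card = I.k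
  penalty_pos : 0 < x.penalty
  time_le : x.time ≤ I.n
  local_opt : x.phase = Phase.waiting → NoEfficientSwap I x.time x.penalty x.medians

lemma IsInitial.invariant {I : Input X} (heps : 0 < I.eps) (hgam : 0 < I.gam) {x : Config X}
    (h : IsInitial I x) : Invariant I x := by
  obtain ⟨h0, hF, hk, hp, -⟩ := h
  have hpos := hp ▸ initPenalty_pos I hgam
  -- Before any arrival every set costs `1 / 10`, so the arbitrary initial medians are locally
  -- optimal.
  refine ⟨hF, hk, hpos, by omega, fun _ A' A hA => ?_⟩
  have h1 := hA.2
  have h2 := le_cost I x.time hpos.le x.medians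
  have h3 : 0 ≤ rho I x.time x.penalty x.medians := by unfold rho; positivity
  have h4 : 0 ≤ (A.card : ℝ) * rho I x.time x.penalty x.medians := by positivity
  simp only [h0] at h1 h4
  simp only [cost, Icc_eq_empty_of_lt Nat.zero_lt_one, sum_empty] at h1
  linarith

lemma Step.invariant {I : Input X} {x y : Config X} (h : Step I x y) (hx : Invariant I x) :
    Invariant I y := by
  cases h with
  | arrive t S p ht => exact ⟨hx.subset, hx.card, hx.penalty_pos, ht, nofun⟩
  | swap t S p A' A h =>
    obtain ⟨⟨hA, hA', hc, -⟩, -⟩ := h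
    have hF : S ⊆ I.F := hx.subset
    have hk : S.card = I.k := hx.card
    refine ⟨?_, ?_, hx.penalty_pos, hx.time_le, nofun⟩
    · exact sdiff_subset.trans (union_subset hF (hA'.trans sdiff_subset))
    · have hd : Disjoint S A' := disjoint_of_subset_right hA' disjoint_sdiff
      have h1 := card_sdiff_add_card_eq_card (hA.trans (subset_union_left (s₂ := A')))
      rw [card_union_of_disjoint hd] at h1
      change ((S ∪ A') \ A).card = I.k
      omega
  | double t S p h ho =>
    exact ⟨hx.subset, hx.card, mul_pos two_pos hx.penalty_pos, hx.time_le, nofun⟩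
  | finish t S p h ho => exact ⟨hx.subset, hx.card, hx.penalty_pos, hx.time_le, fun _ => h⟩

lemma IsRun.invariant {I : Input X} (heps : 0 < I.eps) (hgam : 0 < I.gam) {c : ℕ → Config X}
    {N : ℕ} (h : IsRun I c N) {i : ℕ} (hi : i ≤ N) : Invariant I (c i) := by
  induction i with
  | zero => exact h.1.invariant heps hgam
  | succ i ih => exact (h.2 i hi).invariant (ih (by omega))

lemma Step.time_le {I : Input X} {x y : Config X} (h : Step I x y) : x.time ≤ y.time := by
  cases h <;> simp

lemma Step.eq_of_time_ne {I : Input X} {x y : Config X} (h : Step I x y)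
    (hne : x.time ≠ y.time) :
    x.phase = Phase.waiting ∧ y.time = x.time + 1 ∧ y.medians = x.medians := by
  cases h <;> simp_all

lemma Step.eq_of_penalty_ne {I : Input X} {x y : Config X} (h : Step I x y)
    (hne : y.penalty ≠ x.penalty) :
    NoEfficientSwap I x.time x.penalty x.medians ∧
      outlierThreshold I < numOutliers I x.time x.penalty x.medians ∧
      y.time = x.time ∧ y.medians = x.medians ∧ y.penalty = 2 * x.penalty := by
  cases h <;> simp_all

lemma IsRun.time_mono {I : Input X} {c : ℕ → Config X} {N : ℕ} (h : IsRun I c N) {i j : ℕ}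
    (hij : i ≤ j) (hj : j ≤ N) : (c i).time ≤ (c j).time := by
  induction j, hij using Nat.le_induction with
  | base => rfl
  | succ j hij ih => exact (ih (by omega)).trans (h.2 j hj).time_le

lemma IsRun.exists_time_eq {I : Input X} {c : ℕ → Config X} {N : ℕ} (h : IsRun I c N) {j : ℕ}
    (hj : j ≤ N) {t : ℕ} (ht : t ≤ (c j).time) : ∃ i ≤ j, (c i).time = t := by
  induction j with
  | zero =>
    have := h.1.1
    exact ⟨0, le_rfl, by omega⟩
  | succ j ih =>
    by_cases he : t ≤ (c j).time
    · obtain ⟨i, hi, hit⟩ := ih (by omega) he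
      exact ⟨i, by omega, hit⟩
    · have := (h.2 j hj).eq_of_time_ne (by omega)
      exact ⟨j + 1, le_rfl, by omega⟩

/-- Just before client `t + 1` arrives, the algorithm waits with a local optimum. -/
lemma IsRun.arrivalMoment_spec {I : Input X} {c : ℕ → Config X} {N : ℕ} (h : IsRun I c N)
    {a b t : ℕ} (hab : a ≤ b) (hb : b ≤ N) (hat : (c a).time ≤ t) (htb : t + 1 ≤ (c b).time) :
    ∃ i, arrivalMoment c (t + 1) = i + 1 ∧ a ≤ i ∧ i + 1 ≤ b ∧ (c i).phase = Phase.waiting ∧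
      (c i).time = t ∧ (c (i + 1)).time = t + 1 ∧ (c (i + 1)).medians = (c i).medians := by
  obtain ⟨j, hjb, hj⟩ := h.exists_time_eq hb htb
  have hmem : (c (arrivalMoment c (t + 1))).time = t + 1 :=
    Nat.sInf_mem (s := {i | (c i).time = t + 1}) ⟨j, hj⟩
  have hle : arrivalMoment c (t + 1) ≤ j := Nat.sInf_le hj
  have h0 := h.1.1
  obtain ⟨i, hi⟩ : ∃ i, arrivalMoment c (t + 1) = i + 1 := by
    refine Nat.exists_eq_succ_of_ne_zero fun he => ?_
    rw [he] at hmem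
    omega
  rw [hi] at hmem hle
  -- Minimality of the arrival moment forces the step into it to be an arrival.
  have hne : (c i).time ≠ (c (i + 1)).time := fun he => by
    have : arrivalMoment c (t + 1) ≤ i := Nat.sInf_le (he.trans hmem)
    omega
  obtain ⟨hw, ht, hm⟩ := (h.2 i (by omega)).eq_of_time_ne hne
  refine ⟨i, hi, ?_, by omega, hw, by omega, hmem, hm⟩
  by_contra hlt
  have := h.time_mono (i := i + 1) (j := a) (by omega) (hab.trans hb)
  omega

/-- At the beginning of a stage both the penalty and the cost are within a constant factor of the
cost of every solution. -/
lemma IsStage.start_le {I : Input X} {c : ℕ → Config X} {N a b : ℕ} (hst : IsStage c N a b)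
    (hrun : IsRun I c N) (hk : 1 ≤ I.k) (hell : 1 ≤ I.ell) (heps : 0 < I.eps)
    (heps' : I.eps ≤ 1 / 2) (hgam : 0 < I.gam) {T : Finset X} (hTF : T ⊆ I.F)
    (hTk : T.card = I.k) :
    (c a).penalty ≤ 28 * cost I (c a).time (c a).penalty T ∧
      costAt I c (c a).penalty a ≤ 28 * cost I (c a).time (c a).penalty T := by
  have haN : a ≤ N := hst.le.trans hst.le_end
  have hp := (hrun.invariant heps hgam haN).penalty_pos
  have hT : T.Nonempty := card_pos.mp (by omega)
  rcases Nat.eq_zero_or_pos a with rfl | ha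
  · have h1 := le_cost I (c 0).time hp.le T
    have h2 : (c 0).penalty ≤ 1 / 10 := hrun.1.2.2.2.1 ▸ initPenalty_le I
    have h3 : costAt I c (c 0).penalty 0 = 1 / 10 := by
      simp [costAt, hrun.1.1, cost]
    constructor <;> linarith
  · obtain ⟨i, rfl⟩ : ∃ i, a = i + 1 := ⟨a - 1, by omega⟩
    have hinv := hrun.invariant heps hgam (i := i) (by omega)
    obtain ⟨hopt, hout, ht, hm, hpe⟩ :=
      (hrun.2 i (by omega)).eq_of_penalty_ne (hst.maximal_left i rfl).symm
    have hq := hinv.penalty_pos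
    have hS : (c i).medians.Nonempty := card_pos.mp (by have := hinv.card; omega)
    have hthr : 0 ≤ outlierThreshold I := by
      have : 0 ≤ 1 / (1 - I.eps) := one_div_nonneg.mpr (by linarith)
      unfold outlierThreshold
      positivity
    -- The threshold is nonnegative, so doubling requires at least one outlier, and that client
    -- alone pays the old penalty. With the factor 14 for local optima, doubling gives `28 = 2 *
    -- 14`.
    have h1 := penalty_le_cost I (c i).time hq.le (c i).medians
      (by exact_mod_cast hthr.trans_lt hout)
    have h2 := cost_le_of_noEfficientSwap I hq.le hk hell heps heps' hinv.card hTF hTk hopt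
    have h3 := cost_mono_penalty I (c i).time (by linarith : (c i).penalty ≤ 2 * (c i).penalty) hT
    have h4 := cost_two_mul_le I (c i).time (c i).penalty hS
    rw [costAt, ht, hm, hpe]
    constructor <;> linarith

/-- The cost increase caused by an arrival within a stage. -/
lemma IsStage.delta_succ_le {I : Input X} {c : ℕ → Config X} {N a b : ℕ} (hst : IsStage c N a b)
    (hrun : IsRun I c N) (hk : 1 ≤ I.k) (hell : 1 ≤ I.ell) (heps : 0 < I.eps)
    (heps' : I.eps ≤ 1 / 2) (hgam : 0 < I.gam) {T : Finset X} (hTF : T ⊆ I.F)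
    (hTk : T.card = I.k) {t : ℕ} (hat : (c a).time ≤ t) (htb : t + 1 ≤ (c b).time) {f : ℕ → X}
    (hf : ∀ i, dpSet (c a).penalty (I.client i) T = dp (c a).penalty (I.client i) (f i)) {B : ℝ}
    (hB : cost I t (c a).penalty T ≤ B) :
    Delta I c a (t + 1) ≤ dpSet (c a).penalty (I.client (t + 1)) T +
      2 * (28 * B) * ((classCount f t (f (t + 1)) : ℝ) + 1)⁻¹ := by
  obtain ⟨i, hi, hai, hib, hw, hit, hit', hm⟩ :=
    hrun.arrivalMoment_spec hst.le hst.le_end hat htb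
  have hbN := hst.le_end
  have hinv := hrun.invariant heps hgam (i := i) (by omega)
  have hp : 0 < (c a).penalty := (hrun.invariant heps hgam (by omega)).penalty_pos
  have hS : (c i).medians.Nonempty := card_pos.mp (by have := hinv.card; omega)
  have hopt := hinv.local_opt hw
  rw [hst.const i hai (by omega), hit] at hopt
  have h1 := cost_le_of_noEfficientSwap I hp.le hk hell heps heps' hinv.card hTF hTk hopt
  have hstart := (hst.start_le hrun hk hell heps heps' hgam hTF hTk).1
  have hmono := cost_mono_time I hat hp.le T
  have hpos := le_cost I t hp.le T
  have hD : Delta I c a (t + 1) = dpSet (c a).penalty (I.client (t + 1)) (c i).medians := by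
    rw [Delta, if_neg (by omega), hi, Nat.add_sub_cancel, costAt, costAt, hit, hit', hm, cost_succ]
    ring
  rw [hD]
  -- The constant 28 is dictated by the penalty; the two costs together only need `14 + 1`.
  exact dpSet_arrival_le I hp.le t hS f hf (by linarith) (by linarith)

end Runs

end OnlineKMedian

/-! ### Summation over a stage -/

theorem mainTheorem5 :
    ∃ K : ℝ, 0 < K ∧
      ∀ (X : Type*) [PseudoMetricSpace X] [DecidableEq X] (I : OnlineKMedian.Input X),
        2 ≤ I.n → 1 ≤ I.k → I.k ≤ I.F.card → 1 ≤ I.ell →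
        0 < I.eps → I.eps ≤ 1 / 2 → 0 < I.gam →
        ∀ (c : ℕ → OnlineKMedian.Config X) (N : ℕ), OnlineKMedian.IsRun I c N →
        ∀ a b : ℕ, OnlineKMedian.IsStage c N a b →
        ∀ T : ℕ, (c a).time ≤ T → T ≤ (c b).time →
          ∑ t ∈ Finset.Icc (c a).time T, OnlineKMedian.Delta I c a t ≤
            K * ((I.k : ℝ) * Real.log (I.n : ℝ)) *
              OnlineKMedian.optPrime I T (c a).penalty := by
  -- The total is at most `28 * B + B + 56 * B * k * (1 + log n)`. As `n ≥ 2`, `1 ≤ 2 * log n`,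
  -- which gives `226 = 29 * 2 + 56 * 3`.
  refine ⟨226, by norm_num, ?_⟩
  intro X _ _ I hn hk hkF hell heps heps' hgam c N hrun a b hst T haT hTb
  obtain ⟨S, hSF, hSk, hopt⟩ := OnlineKMedian.exists_optPrime_eq I T (c a).penalty hkF
  rw [hopt]
  have hbN := hst.le_end
  have hab := hst.le
  have hp : 0 < (c a).penalty := (hrun.invariant heps hgam (by omega)).penalty_pos
  have hTn : T ≤ I.n := hTb.trans (hrun.invariant heps hgam hbN).time_le
  have hS : S.Nonempty := Finset.card_pos.mp (by omega)
  choose f hfS hf using fun i : ℕ =>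
    OnlineKMedian.exists_dpSet_eq (c a).penalty (I.client i) hS
  set p := (c a).penalty
  set B := OnlineKMedian.cost I T p S with hB
  have hB0 : 1 / 10 ≤ B := OnlineKMedian.le_cost I T hp.le S
  set g : ℕ → ℝ := fun t => OnlineKMedian.dpSet p (I.client t) S +
    2 * (28 * B) * ((OnlineKMedian.classCount f (t - 1) (f t) : ℝ) + 1)⁻¹ with hg
  have hg0 : ∀ t, 0 ≤ g t := fun t =>
    add_nonneg (OnlineKMedian.dpSet_nonneg hp.le _ S) (by positivity)
  have hfirst : OnlineKMedian.Delta I c a (c a).time ≤ 28 * B := by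
    have h1 := (hst.start_le hrun hk hell heps heps' hgam hSF hSk).2
    have h2 := OnlineKMedian.cost_mono_time I haT hp.le S
    rw [OnlineKMedian.Delta, if_pos rfl]
    linarith
  have hlater : ∀ t ∈ Finset.Ioc (c a).time T, OnlineKMedian.Delta I c a t ≤ g t := by
    intro t ht
    obtain ⟨ht1, ht2⟩ := Finset.mem_Ioc.mp ht
    obtain ⟨s, rfl⟩ : ∃ s, t = s + 1 := ⟨t - 1, by omega⟩
    exact hst.delta_succ_le hrun hk hell heps heps' hgam hSF hSk (by omega) (by omega) hf
      (OnlineKMedian.cost_mono_time I (by omega) hp.le S)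
  have hsum : ∑ t ∈ Finset.Ioc (c a).time T, OnlineKMedian.Delta I c a t ≤
      ∑ t ∈ Finset.Icc 1 T, g t := by
    refine (Finset.sum_le_sum hlater).trans
      (Finset.sum_le_sum_of_subset_of_nonneg ?_ fun t _ _ => hg0 t)
    intro t ht
    rw [Finset.mem_Ioc] at ht
    rw [Finset.mem_Icc]
    omega
  have hharm := OnlineKMedian.sum_inv_classCount_le f hfS (by omega : 1 ≤ I.n) hTn
  rw [hSk] at hharm
  have hgs : ∑ t ∈ Finset.Icc 1 T, g t ≤ B + 2 * (28 * B) * (I.k * (1 + Real.log I.n)) := by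
    rw [hg, Finset.sum_add_distrib, ← Finset.mul_sum]
    have h1 := mul_le_mul_of_nonneg_left hharm (by positivity : 0 ≤ 2 * (28 * B))
    have h2 : B = 1 / 10 + ∑ t ∈ Finset.Icc 1 T, OnlineKMedian.dpSet p (I.client t) S := rfl
    linarith
  rw [← Finset.add_sum_Ioc_eq_sum_Icc haT]
  have hlog : 1 ≤ 2 * Real.log I.n := by
    have h1 := Real.log_le_log two_pos (by exact_mod_cast hn : (2 : ℝ) ≤ I.n)
    have h2 := Real.log_two_gt_d9
    linarith
  have hk1 : (1 : ℝ) ≤ I.k := by exact_mod_cast hk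
  have hkl : 1 + Real.log I.n ≤ 3 * Real.log I.n := by linarith
  have h3 : B * (I.k * (1 + Real.log I.n)) ≤ B * (I.k * (3 * Real.log I.n)) := by gcongr
  have h4 : B * 1 ≤ B * (I.k * (2 * Real.log I.n)) :=
    mul_le_mul_of_nonneg_left (one_le_mul_of_one_le_of_one_le hk1 hlog) (by linarith)
  linarith
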